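/- Let $\alpha\in(1,2]$, let $\beta\ge 2$ be the conjugate exponent, $\frac1\alpha+\frac1\beta=1$, and let $\mu_\alpha$ be the probability measure on $\mathbb R$ given by $\mu_\alpha(dx)=Z_\alpha^{-1}e^{-|x|^\alpha}\,dx$, where $Z_\alpha=\int_{\mathbb R}e^{-|x|^\alpha}\,dx$. There exist constants $A,B>0$, depending only on $\alpha$, such that for every $C^\infty$ function $f:\mathbb R\to\mathbb R$ with $f\in L^2(\mu_\alpha)$ (not necessarily nonnegative or normalized), $$\mathrm{Ent}_{\mu_\alpha}(f^2)\le A\,\mathrm{Var}_{\mu_\alpha}(f)+B\int_{\Omega}\left|\frac{f'}{f}\right|^\beta f^2\,d\mu_\alpha .$$ Here $$\mathrm{Ent}_{\mu_\alpha}(f^2)=\int f^2\log\frac{f^2}{\int f^2d\mu_\alpha}\,d\mu_\alpha,\qquad \mathrm{Var}_{\mu_\alpha}(f)=\int f^2d\mu_\alpha-\Big(\int f\,d\mu_\alpha\Big)^2,$$ $$\Omega=\Big\{f_+\ge 2\Big(\int f_+^2d\mu_\alpha\Big)^{1/2}\Big\}\cup\Big\{f_-\ge 2\Big(\int f_-^2d\mu_\alpha\Big)^{1/2}\Big\},\qquad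 f_+=\max(f,0),\quad f_-=\max(-f,0).$$ The integrands $f^2\log\big(f^2/\int f^2d\mu_\alpha\big)$ and $|f'/f|^\beta f^2$ are taken to be $0$ at the points where $f=0$. The right-hand side may be $+\infty$, in which case nothing is asserted; when it is finite, the function $f^2\log\big(f^2/\int f^2d\mu_\alpha\big)$ is $\mu_\alpha$-integrable and the inequality holds. -/

import Mathlib

open MeasureTheory ProbabilityTheory
open scoped ContDiff

/-- The normalizing constant `∫ exp (-|x| ^ α) dx`. -/
noncomputable def partitionConst (α : ℝ) : ℝ := ∫ x : ℝ, Real.exp (-|x| ^ α)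

/-- The measure on the real line with Lebesgue density `exp (-|x| ^ α) / Z`, where `Z` is the
normalizing constant. -/
noncomputable def muAlpha (α : ℝ) : Measure ℝ :=
  (volume : Measure ℝ).withDensity
    (fun x => ENNReal.ofReal (Real.exp (-|x| ^ α) / partitionConst α))

/-- The integrand `g log (g / ∫ g dμ)` of the entropy (`0` where `g` vanishes). -/
noncomputable def entIntegrand (μ : Measure ℝ) (g : ℝ → ℝ) (x : ℝ) : ℝ :=
  g x * Real.log (g x / ∫ y, g y ∂μ)

/-- The entropy `∫ g log (g / ∫ g dμ) dμ` of a nonnegative function `g`. -/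
noncomputable def ent (μ : Measure ℝ) (g : ℝ → ℝ) : ℝ := ∫ x, entIntegrand μ g x ∂μ

/-- The positive part `max (f, 0)`. -/
def fPlus (f : ℝ → ℝ) (x : ℝ) : ℝ := max (f x) 0

/-- The negative part `max (-f, 0)`. -/
def fMinus (f : ℝ → ℝ) (x : ℝ) : ℝ := max (-f x) 0

/-- The set where the positive part of `f`, or the negative part of `f`, is at least twice its
own norm in `L²(μ)`. -/
def bigSet (μ : Measure ℝ) (f : ℝ → ℝ) : Set ℝ :=
  {x | 2 * Real.sqrt (∫ y, fPlus f y ^ 2 ∂μ) ≤ fPlus f x} ∪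
    {x | 2 * Real.sqrt (∫ y, fMinus f y ^ 2 ∂μ) ≤ fMinus f x}

/-- The function `|f' / f| ^ β f ^ 2` (`0` where `f` vanishes). -/
noncomputable def energyIntegrand (β : ℝ) (f : ℝ → ℝ) (x : ℝ) : ℝ :=
  |deriv f x / f x| ^ β * f x ^ 2

open Filter Topology

/-! Entropy is subadditive for f² = f₊² + f₋², while Var f exceeds Var f₊ + Var f₋ by twice the
product of the two means, which is nonnegative. So it suffices to treat t = f₊, and by homogeneity ∫
t² = 1.

With m = ∫ t, the quantity ∫ (t - 1)² = 2 - 2m is at most twice the variance. It controls t² log t²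
- t² + 1 wherever t is bounded (`sq_mul_log_sq_le`). For large t, replace t^(2/β) by a C¹ truncation
k vanishing for t ≤ 2: then k^β is comparable to t², and |k'|^β is at most the energy density on {t
≥ 2}.

Two bounds on k^β finish the proof (`exists_weighted_bound`), with H = C (∫ k^β + ∫ |k'|^β).
Integrating the derivative of x k^β times the density bounds the α-moment ∫ |x|^α k^β dμ by H.
Integrating the derivative of k^β times the density gives k^β ≤ H exp(|x|^α). Hence log t² ≤ const +
H + |x|^α where t is large, and integrating this against k^β costs only multiples of ∫ k^β and H,
because ∫ k^β ≤ 1. -/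

/-- The Lebesgue density of `muAlpha α`. -/
noncomputable def densAlpha (α x : ℝ) : ℝ := Real.exp (-|x| ^ α) / partitionConst α

/-! ### The measure and its density. -/

lemma partitionConst_pos {α : ℝ} (hα : 0 < α) : 0 < partitionConst α := by
  have h : partitionConst α = 2 * Real.Gamma (1 / α + 1) := by
    rw [← integral_exp_neg_rpow hα, partitionConst]
    exact integral_comp_abs (f := fun x => Real.exp (-x ^ α))
  rw [h]
  have : 0 < Real.Gamma (1 / α + 1) := Real.Gamma_pos_of_pos (by positivity)
  positivity

/-- A non-integrable function has integral 0 by convention, whereas this integral is positive. -/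
lemma integrable_exp_neg_abs_rpow {α : ℝ} (hα : 0 < α) :
    Integrable (fun x : ℝ => Real.exp (-|x| ^ α)) := by
  by_contra h
  exact (partitionConst_pos hα).ne' (integral_undef h)

lemma densAlpha_pos {α : ℝ} (hα : 0 < α) (x : ℝ) : 0 < densAlpha α x :=
  div_pos (Real.exp_pos _) (partitionConst_pos hα)

lemma continuous_densAlpha {α : ℝ} (hα : 0 < α) : Continuous (densAlpha α) := by
  unfold densAlpha
  exact (Real.continuous_exp.comp
    (continuous_abs.rpow_const fun _ => Or.inr hα.le).neg).div_const _

lemma hasDerivAt_densAlpha {α : ℝ} (hα : 1 < α) (x : ℝ) :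
    HasDerivAt (densAlpha α) (-(α * |x| ^ (α - 2) * x) * densAlpha α x) x := by
  have h := ((hasDerivAt_abs_rpow x hα).neg.exp).div_const (partitionConst α)
  refine h.congr_deriv ?_
  simp only [densAlpha, Pi.neg_apply]
  ring

lemma abs_rpow_sub_two_mul_sq {α : ℝ} (hα : 0 < α) (x : ℝ) :
    |x| ^ (α - 2) * x * x = |x| ^ α := by
  rcases eq_or_ne x 0 with rfl | hx
  · simp [Real.zero_rpow hα.ne']
  · have h : 0 < |x| := abs_pos.2 hx
    have : |x| ^ α = |x| ^ (α - 2) * |x| ^ (2 : ℝ) := by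
      rw [← Real.rpow_add h]; congr 1; ring
    rw [this, Real.rpow_two, sq_abs]; ring

/-- Up to the factor α this is the derivative of |x|^α, which is C¹ for α > 1; the singular factor
at 0 is therefore harmless. -/
lemma continuous_abs_rpow_sub_two_mul {α : ℝ} (hα : 1 < α) :
    Continuous fun x : ℝ => |x| ^ (α - 2) * x := by
  have h : (fun x : ℝ => |x| ^ (α - 2) * x) = fun x => x.sign * |x| ^ (α - 1) := by
    funext x
    rcases eq_or_ne x 0 with rfl | hx
    · simp
    · have h : 0 < |x| := abs_pos.2 hx
      have h1 : |x| ^ (α - 1) = |x| ^ (α - 2) * |x| := by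
        nth_rewrite 3 [← Real.rpow_one |x|]
        rw [← Real.rpow_add h]; congr 1; ring
      rw [h1]
      rcases lt_or_gt_of_ne hx with h2 | h2
      · rw [Real.sign_of_neg h2, abs_of_neg h2]; ring
      · rw [Real.sign_of_pos h2, abs_of_pos h2]; ring
  have h2 : ContDiff ℝ 1 fun x : ℝ => |x| ^ α := by
    simpa using contDiff_norm_rpow (E := ℝ) hα
  have h3 := (h2.continuous_deriv le_rfl).div_const α
  convert h3 using 2 with x
  rw [(hasDerivAt_abs_rpow x hα).deriv]
  field_simp

lemma muAlpha_eq_withDensity (α : ℝ) :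
    muAlpha α = volume.withDensity fun x => ENNReal.ofReal (densAlpha α x) := rfl

lemma integrable_muAlpha_iff {α : ℝ} (hα : 0 < α) (g : ℝ → ℝ) :
    Integrable g (muAlpha α) ↔ Integrable fun x => densAlpha α x * g x := by
  rw [muAlpha_eq_withDensity, integrable_withDensity_iff_integrable_smul'
    ((continuous_densAlpha hα).measurable.ennreal_ofReal) (by simp)]
  refine integrable_congr (Eventually.of_forall fun x => ?_)
  simp only [smul_eq_mul]
  rw [ENNReal.toReal_ofReal (densAlpha_pos hα x).le]

lemma integral_muAlpha {α : ℝ} (hα : 0 < α) (g : ℝ → ℝ) :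
    ∫ x, g x ∂(muAlpha α) = ∫ x, densAlpha α x * g x := by
  rw [muAlpha_eq_withDensity, integral_withDensity_eq_integral_toReal_smul
    ((continuous_densAlpha hα).measurable.ennreal_ofReal) (by simp)]
  refine integral_congr_ae (Eventually.of_forall fun x => ?_)
  simp only [smul_eq_mul]
  rw [ENNReal.toReal_ofReal (densAlpha_pos hα x).le]

lemma isProbabilityMeasure_muAlpha {α : ℝ} (hα : 0 < α) :
    IsProbabilityMeasure (muAlpha α) := by
  constructor
  rw [muAlpha, withDensity_apply _ MeasurableSet.univ, Measure.restrict_univ,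
    ← ofReal_integral_eq_lintegral_ofReal ((integrable_exp_neg_abs_rpow hα).div_const _)
      (Eventually.of_forall fun x => (densAlpha_pos hα x).le), integral_div]
  change ENNReal.ofReal (partitionConst α / partitionConst α) = 1
  rw [div_self (partitionConst_pos hα).ne', ENNReal.ofReal_one]

/-! ### Moment and pointwise bounds for the weight exp(-|x|^α). -/

/-- A weighted inequality for `muAlpha`: the moment of order `α` of a nonnegative function is
controlled by its mass and by a function dominating its derivative. -/
lemma integrable_abs_rpow_mul_muAlpha {α C : ℝ} (hα : 1 < α) {F F' P : ℝ → ℝ}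
    (hF : ∀ x, 0 ≤ F x) (hd : ∀ x, HasDerivAt F (F' x) x) (hc : Continuous F')
    (hP : ∀ x, 0 ≤ P x) (hPc : Continuous P) (hC : 0 ≤ C)
    (h1 : ∀ x, |F' x * x| ≤ α / 2 * (|x| ^ α * F x) + C * P x)
    (hFi : Integrable F (muAlpha α)) (hPi : Integrable P (muAlpha α)) :
    Integrable (fun x => |x| ^ α * F x) (muAlpha α) ∧
      ∫ x, |x| ^ α * F x ∂(muAlpha α) ≤
        2 / α * (∫ x, F x ∂(muAlpha α) + C * ∫ x, P x ∂(muAlpha α)) := by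
  have hα0 : 0 < α := by linarith
  rw [integrable_muAlpha_iff hα0] at hFi hPi ⊢
  simp only [integral_muAlpha hα0]
  set q := densAlpha α with hq
  have hq0 : ∀ x, 0 < q x := densAlpha_pos hα0
  have hqc : Continuous q := continuous_densAlpha hα0
  have hFc : Continuous F := continuous_iff_continuousAt.2 fun x => (hd x).continuousAt
  have hpc : Continuous fun x : ℝ => |x| ^ α :=
    continuous_abs.rpow_const fun _ => Or.inr hα0.le
  have hm : ∀ x, 0 ≤ q x * (|x| ^ α * F x) := fun x =>
    mul_nonneg (hq0 x).le (mul_nonneg (by positivity) (hF x))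
  have hmc : Continuous fun x => q x * (|x| ^ α * F x) := hqc.mul (hpc.mul hFc)
  have hqF : Continuous fun x => q x * F x := hqc.mul hFc
  have hqP : Continuous fun x => q x * P x := hqc.mul hPc
  have hqF' : Continuous fun x => q x * (F' x * x) := hqc.mul (hc.mul continuous_id)
  have key : ∀ R : ℝ, 0 ≤ R → ∫ x in -R..R, q x * (|x| ^ α * F x) ≤
      2 / α * ((∫ x, q x * F x) + C * ∫ x, q x * P x) := by
    intro R hR
    have hRR : -R ≤ R := by linarith
    -- Differentiating the density in x F q produces the moment with coefficient α; hypothesis `h1`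
    -- gives back only half of it, which is absorbed.
    have ftc : ∫ x in -R..R, (q x * F x + q x * (F' x * x) - α * (q x * (|x| ^ α * F x))) =
        R * F R * q R - (-R) * F (-R) * q (-R) := by
      refine intervalIntegral.integral_eq_sub_of_hasDerivAt
        (f := fun x => x * F x * q x) (fun x _ => ?_) ?_
      · refine (((hasDerivAt_id x).mul (hd x)).mul (hasDerivAt_densAlpha hα x)).congr_deriv ?_
        rw [← abs_rpow_sub_two_mul_sq hα0 x]
        simp only [id, Pi.mul_apply, ← hq]
        ring
      · exact ((hqF.add hqF').sub (continuous_const.mul hmc)).intervalIntegrable _ _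
    have i1 : IntervalIntegrable (fun x => q x * F x + q x * (F' x * x)) volume (-R) R :=
      (hqF.add hqF').intervalIntegrable _ _
    have i2 : IntervalIntegrable (fun x => α * (q x * (|x| ^ α * F x))) volume (-R) R :=
      (continuous_const.mul hmc).intervalIntegrable _ _
    rw [intervalIntegral.integral_sub i1 i2,
      intervalIntegral.integral_add (hqF.intervalIntegrable _ _) (hqF'.intervalIntegrable _ _),
      intervalIntegral.integral_const_mul] at ftc
    -- Both boundary terms have the favourable sign, so no decay of F is needed.
    have hb : 0 ≤ R * F R * q R - (-R) * F (-R) * q (-R) := by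
      have e1 := mul_nonneg (mul_nonneg hR (hF R)) (hq0 R).le
      have e2 := mul_nonneg (mul_nonneg hR (hF (-R))) (hq0 (-R)).le
      linarith
    have b1 : ∫ x in -R..R, q x * F x ≤ ∫ x, q x * F x := by
      rw [intervalIntegral.integral_of_le hRR]
      exact setIntegral_le_integral hFi
        (Eventually.of_forall fun x => mul_nonneg (hq0 x).le (hF x))
    have b2 : ∫ x in -R..R, q x * P x ≤ ∫ x, q x * P x := by
      rw [intervalIntegral.integral_of_le hRR]
      exact setIntegral_le_integral hPi
        (Eventually.of_forall fun x => mul_nonneg (hq0 x).le (hP x))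
    have b3 : ∫ x in -R..R, q x * (F' x * x) ≤
        α / 2 * (∫ x in -R..R, q x * (|x| ^ α * F x)) + C * ∫ x in -R..R, q x * P x := by
      have j1 : IntervalIntegrable (fun x => α / 2 * (q x * (|x| ^ α * F x))) volume (-R) R :=
        (continuous_const.mul hmc).intervalIntegrable _ _
      have j2 : IntervalIntegrable (fun x => C * (q x * P x)) volume (-R) R :=
        (continuous_const.mul hqP).intervalIntegrable _ _
      rw [← intervalIntegral.integral_const_mul, ← intervalIntegral.integral_const_mul,
        ← intervalIntegral.integral_add j1 j2]
      refine intervalIntegral.integral_mono_on hRR (hqF'.intervalIntegrable _ _) (j1.add j2)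
        fun x _ => ?_
      have := mul_le_mul_of_nonneg_left ((le_abs_self _).trans (h1 x)) (hq0 x).le
      linarith
    have b4 := mul_le_mul_of_nonneg_left b2 hC
    rw [div_mul_eq_mul_div, le_div_iff₀ hα0]
    linarith
  have hint : Integrable fun x => q x * (|x| ^ α * F x) := by
    refine integrable_of_intervalIntegral_norm_bounded (l := atTop)
      (a := fun R : ℝ => -R) (b := fun R => R)
      (2 / α * ((∫ x, q x * F x) + C * ∫ x, q x * P x)) (fun R => (hmc.integrableOn_Icc).mono_set Set.Ioc_subset_Icc_self)
      tendsto_neg_atTop_atBot tendsto_id ?_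
    filter_upwards [eventually_ge_atTop 0] with R hR
    simp only [Real.norm_of_nonneg (hm _)]
    exact key R hR
  refine ⟨hint, le_of_tendsto (intervalIntegral_tendsto_integral hint tendsto_neg_atTop_atBot
    tendsto_id) ?_⟩
  filter_upwards [eventually_ge_atTop 0] with R hR using key R hR

/-- Under the same kind of control, `F` times the density of `muAlpha` is bounded. -/
lemma mul_densAlpha_le {α C : ℝ} (hα : 1 < α) {F F' P : ℝ → ℝ}
    (hF : ∀ x, 0 ≤ F x) (hd : ∀ x, HasDerivAt F (F' x) x) (hc : Continuous F')
    (h2 : ∀ x, |F' x| ≤ C * (F x + P x))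
    (hFi : Integrable F (muAlpha α)) (hPi : Integrable P (muAlpha α))
    (hMi : Integrable (fun x => |x| ^ α * F x) (muAlpha α)) (x : ℝ) :
    densAlpha α x * F x ≤ C * (∫ x, F x ∂(muAlpha α) + ∫ x, P x ∂(muAlpha α)) +
      α * (∫ x, F x ∂(muAlpha α) + ∫ x, |x| ^ α * F x ∂(muAlpha α)) := by
  have hα0 : 0 < α := by linarith
  rw [integrable_muAlpha_iff hα0] at hFi hPi hMi
  simp only [integral_muAlpha hα0]
  set q := densAlpha α with hq
  have hq0 : ∀ x, 0 < q x := densAlpha_pos hα0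
  have hqc : Continuous q := continuous_densAlpha hα0
  have hFc : Continuous F := continuous_iff_continuousAt.2 fun x => (hd x).continuousAt
  set w' : ℝ → ℝ := fun x => -(α * |x| ^ (α - 2) * x) * q x * F x + q x * F' x with hw'
  have hwd : ∀ x, HasDerivAt (fun x => q x * F x) (w' x) x := fun x =>
    (hasDerivAt_densAlpha hα x).mul (hd x)
  have hwc : Continuous w' := by
    have h3 := continuous_abs_rpow_sub_two_mul hα
    have h4 : w' = fun x => -(α * (|x| ^ (α - 2) * x)) * q x * F x + q x * F' x := by
      funext x; simp only [hw']; ring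
    rw [h4]
    fun_prop
  set B : ℝ → ℝ := fun x => C * (q x * F x + q x * P x) +
    α * (q x * F x + q x * (|x| ^ α * F x)) with hB
  have hBi : Integrable B := ((hFi.add hPi).const_mul C).add ((hFi.add hMi).const_mul α)
  have hle : ∀ x, |w' x| ≤ B x := by
    intro x
    -- The logarithmic derivative of the density has size α |x|^(α-1); this bounds it by the mass
    -- and the α-moment.
    have e0 : |(|x| ^ (α - 2) * x)| ≤ 1 + |x| ^ α := by
      rcases eq_or_ne x 0 with rfl | hx
      · simp; positivity
      have h : 0 < |x| := abs_pos.2 hx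
      have e : |(|x| ^ (α - 2) * x)| = |x| ^ (α - 1) := by
        rw [abs_mul, abs_of_nonneg (by positivity : 0 ≤ |x| ^ (α - 2))]
        nth_rewrite 2 [← Real.rpow_one |x|]
        rw [← Real.rpow_add h]; congr 1; ring
      rw [e]
      rcases le_total |x| 1 with h' | h'
      · have := Real.rpow_le_one h.le h' (by linarith : 0 ≤ α - 1)
        have : 0 ≤ |x| ^ α := by positivity
        linarith
      · have := Real.rpow_le_rpow_of_exponent_le h' (by linarith : α - 1 ≤ α)
        linarith
    have e1 : |-(α * |x| ^ (α - 2) * x) * q x * F x| ≤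
        α * (q x * F x + q x * (|x| ^ α * F x)) := by
      have : -(α * |x| ^ (α - 2) * x) * q x * F x =
          -((α * q x * F x) * (|x| ^ (α - 2) * x)) := by ring
      have h0 : 0 ≤ α * q x * F x := mul_nonneg (mul_nonneg hα0.le (hq0 x).le) (hF x)
      rw [this, abs_neg, abs_mul, abs_of_nonneg h0]
      refine (mul_le_mul_of_nonneg_left e0 h0).trans_eq (by ring)
    have e2 : |q x * F' x| ≤ C * (q x * F x + q x * P x) := by
      rw [abs_mul, abs_of_pos (hq0 x)]
      refine (mul_le_mul_of_nonneg_left (h2 x) (hq0 x).le).trans_eq (by ring)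
    refine (abs_add_le _ _).trans ?_
    simp only [hB]
    linarith
  have hwi : Integrable w' := hBi.mono' hwc.aestronglyMeasurable (Eventually.of_forall hle)
  -- A function integrable together with its derivative tends to 0, so qF at x is minus the integral
  -- of its derivative over (x, ∞).
  have hlim : Tendsto (fun x => q x * F x) atTop (𝓝 0) :=
    tendsto_zero_of_hasDerivAt_of_integrableOn_Ioi (a := x) (fun y _ => hwd y)
      hwi.integrableOn hFi.integrableOn
  have hval := integral_Ioi_of_hasDerivAt_of_tendsto' (a := x) (fun y _ => hwd y)
      hwi.integrableOn hlim
  have hBint : ∫ y, B y = C * ((∫ x, q x * F x) + ∫ x, q x * P x) +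
      α * ((∫ x, q x * F x) + ∫ x, q x * (|x| ^ α * F x)) := by
    simp only [hB]
    have i1 : Integrable fun x => C * (q x * F x + q x * P x) := (hFi.add hPi).const_mul C
    have i2 : Integrable fun x => α * (q x * F x + q x * (|x| ^ α * F x)) :=
      (hFi.add hMi).const_mul α
    rw [integral_add i1 i2,
      integral_const_mul, integral_const_mul, integral_add hFi hPi, integral_add hFi hMi]
  rw [← hBint]
  calc q x * F x = -∫ y in Set.Ioi x, w' y := by rw [hval]; ring
    _ ≤ |∫ y in Set.Ioi x, w' y| := neg_le_abs _
    _ ≤ ∫ y in Set.Ioi x, |w' y| := abs_integral_le_integral_abs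
    _ ≤ ∫ y, |w' y| := setIntegral_le_integral hwi.abs (Eventually.of_forall fun _ => abs_nonneg _)
    _ ≤ ∫ y, B y := integral_mono hwi.abs hBi hle

/-- Young's inequality for εa and b/ε, with ε chosen so that β ε^α / α = α/2, the share that the
moment bound can absorb. -/
lemma exists_scaled_young {α β : ℝ} (h : α.HolderConjugate β) :
    ∃ C : ℝ, 0 ≤ C ∧ ∀ a b : ℝ, 0 ≤ a → 0 ≤ b → β * (a * b) ≤ α / 2 * a ^ α + C * b ^ β := by
  have hα : 0 < α := h.pos
  have hβ : 0 < β := h.symm.pos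
  set ε : ℝ := (α ^ 2 / (2 * β)) ^ (1 / α) with hε
  have hε0 : 0 < ε := by positivity
  have hεα : ε ^ α = α ^ 2 / (2 * β) := by
    rw [hε, ← Real.rpow_mul (by positivity), one_div_mul_cancel hα.ne', Real.rpow_one]
  refine ⟨(ε⁻¹) ^ β, by positivity, fun a b ha hb => ?_⟩
  have key := Real.young_inequality_of_nonneg (a := ε * a) (b := ε⁻¹ * b)
    (by positivity) (by positivity) h
  rw [Real.mul_rpow hε0.le ha, Real.mul_rpow (by positivity) hb, hεα] at key
  have e : ε * a * (ε⁻¹ * b) = a * b := by field_simp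
  rw [e] at key
  refine (mul_le_mul_of_nonneg_left key hβ.le).trans_eq ?_
  field_simp

/-- Take F = k^β and P = |k'|^β in the two preceding bounds. Since F' = β k^(β-1) k' and α(β-1) = β,
the scaled Young inequality with a = |x| k^(β-1), respectively a = k^(β-1), supplies their
hypotheses. -/
lemma exists_weighted_bound {α β : ℝ} (h : α.HolderConjugate β) :
    ∃ C : ℝ, 0 < C ∧ ∀ k k' : ℝ → ℝ, (∀ x, 0 ≤ k x) → (∀ x, HasDerivAt k (k' x) x) →
      Continuous k' → Integrable (fun x => k x ^ β) (muAlpha α) →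
      Integrable (fun x => |k' x| ^ β) (muAlpha α) →
      Integrable (fun x => |x| ^ α * k x ^ β) (muAlpha α) ∧
      ∫ x, |x| ^ α * k x ^ β ∂(muAlpha α) ≤
        C * (∫ x, k x ^ β ∂(muAlpha α) + ∫ x, |k' x| ^ β ∂(muAlpha α)) ∧
      ∀ x, k x ^ β ≤ C * (∫ x, k x ^ β ∂(muAlpha α) + ∫ x, |k' x| ^ β ∂(muAlpha α)) *
        Real.exp (|x| ^ α) := by
  obtain ⟨C₀, hC₀, hY⟩ := exists_scaled_young h
  have hα : 1 < α := h.lt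
  have hα0 : 0 < α := h.pos
  have hβ : 1 < β := h.symm.lt
  have hβ0 : 0 < β := h.symm.pos
  have hZ := partitionConst_pos hα0
  set Z := partitionConst α with hZd
  set C₁ := 2 / α * (1 + C₀) with hC₁
  set C₂ := (α / 2 + C₀) + α * (1 + C₁) with hC₂
  have hC₁0 : 0 < C₁ := by positivity
  have hC₂0 : 0 < C₂ := by positivity
  refine ⟨C₁ + Z * C₂, by positivity, fun k k' hk hd hc hki hki' => ?_⟩
  have hkc : Continuous k := continuous_iff_continuousAt.2 fun x => (hd x).continuousAt
  have hFd : ∀ x, HasDerivAt (fun x => k x ^ β) (k' x * β * k x ^ (β - 1)) x := fun x =>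
    (hd x).rpow_const (Or.inr hβ.le)
  have hF'c : Continuous fun x => k' x * β * k x ^ (β - 1) :=
    (hc.mul continuous_const).mul (hkc.rpow_const fun _ => Or.inr (by linarith))
  have hpow : ∀ x, (k x ^ (β - 1)) ^ α = k x ^ β := fun x => by
    rw [← Real.rpow_mul (hk x)]
    congr 1
    have := h.sub_one_mul_conj
    have e := h.mul_eq_add
    linarith
  have h1 : ∀ x, |k' x * β * k x ^ (β - 1) * x| ≤
      α / 2 * (|x| ^ α * k x ^ β) + C₀ * |k' x| ^ β := fun x => by
    have h0 : 0 ≤ k x ^ (β - 1) := Real.rpow_nonneg (hk x) _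
    have := hY (|x| * k x ^ (β - 1)) |k' x| (by positivity) (abs_nonneg _)
    rw [Real.mul_rpow (abs_nonneg _) h0, hpow] at this
    rw [abs_mul, abs_mul, abs_mul, abs_of_pos hβ0, abs_of_nonneg h0]
    linarith
  have h2 : ∀ x, |k' x * β * k x ^ (β - 1)| ≤ (α / 2 + C₀) * (k x ^ β + |k' x| ^ β) := fun x => by
    have h0 : 0 ≤ k x ^ (β - 1) := Real.rpow_nonneg (hk x) _
    have := hY (k x ^ (β - 1)) |k' x| h0 (abs_nonneg _)
    rw [hpow] at this
    rw [abs_mul, abs_mul, abs_of_pos hβ0, abs_of_nonneg h0]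
    have e1 : 0 ≤ C₀ * k x ^ β := mul_nonneg hC₀ (Real.rpow_nonneg (hk x) _)
    have e2 : 0 ≤ α / 2 * |k' x| ^ β := by positivity
    linarith
  set S := ∫ x, k x ^ β ∂(muAlpha α) with hS
  set D := ∫ x, |k' x| ^ β ∂(muAlpha α) with hD
  have hS0 : 0 ≤ S := integral_nonneg fun x => Real.rpow_nonneg (hk x) _
  have hD0 : 0 ≤ D := integral_nonneg fun x => by positivity
  obtain ⟨hi, hle⟩ := integrable_abs_rpow_mul_muAlpha hα
    (fun x => Real.rpow_nonneg (hk x) β) hFd hF'c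
    (fun x => Real.rpow_nonneg (abs_nonneg (k' x)) β)
    (hc.abs.rpow_const fun _ => Or.inr hβ0.le) hC₀ h1 hki hki'
  have hle' : ∫ x, |x| ^ α * k x ^ β ∂(muAlpha α) ≤ C₁ * (S + D) := by
    refine hle.trans ?_
    rw [hC₁, mul_assoc]
    refine mul_le_mul_of_nonneg_left ?_ (by positivity)
    nlinarith [mul_nonneg hC₀ hS0]
  refine ⟨hi, hle'.trans ?_, fun x => ?_⟩
  · exact mul_le_mul_of_nonneg_right (by linarith [mul_pos hZ hC₂0]) (by positivity)
  have hb := mul_densAlpha_le hα (fun x => Real.rpow_nonneg (hk x) β) hFd hF'c h2 hki hki' hi x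
  have hb' : densAlpha α x * k x ^ β ≤ C₂ * (S + D) := by
    refine hb.trans ?_
    have := mul_le_mul_of_nonneg_left hle' hα0.le
    have := mul_nonneg hα0.le hD0
    rw [hC₂]
    linarith
  have hdens : densAlpha α x = (Z * Real.exp (|x| ^ α))⁻¹ := by
    rw [densAlpha, Real.exp_neg, ← hZd]
    field_simp
  rw [hdens, inv_mul_le_iff₀ (by positivity)] at hb'
  have : 0 ≤ C₁ * (S + D) * Real.exp (|x| ^ α) := by positivity
  linarith

/-! ### The truncation. -/

/-- A `C¹` truncation of `t ↦ max t 0 ^ (2 / β)` which vanishes for `t ≤ 2`. -/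
noncomputable def cutoff (β t : ℝ) : ℝ := ((max t 2) ^ (1 / β) - 2 ^ (1 / β)) ^ 2

/-- The derivative of `cutoff β`. -/
noncomputable def cutoffDeriv (β t : ℝ) : ℝ :=
  2 * ((max t 2) ^ (1 / β) - 2 ^ (1 / β)) * (1 / β * (max t 2) ^ (1 / β - 1))

lemma cutoff_nonneg (β t : ℝ) : 0 ≤ cutoff β t := sq_nonneg _

lemma cutoff_of_le {t : ℝ} (β : ℝ) (ht : t ≤ 2) : cutoff β t = 0 := by
  simp [cutoff, max_eq_right ht]

lemma cutoffDeriv_of_le {t : ℝ} (β : ℝ) (ht : t ≤ 2) : cutoffDeriv β t = 0 := by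
  simp [cutoffDeriv, max_eq_right ht]

lemma continuous_cutoffDeriv (β : ℝ) : Continuous (cutoffDeriv β) := by
  have h : ∀ p : ℝ, Continuous fun t : ℝ => (max t 2) ^ p := fun p =>
    (continuous_id.max continuous_const).rpow_const fun t =>
      Or.inl (by positivity)
  have h1 := h (1 / β)
  have h2 := h (1 / β - 1)
  unfold cutoffDeriv
  fun_prop

/-- The square in the truncation kills the derivative at t = 2, so the one-sided derivatives agree
there. -/
lemma hasDerivAt_cutoff (β t : ℝ) : HasDerivAt (cutoff β) (cutoffDeriv β t) t := by
  have left : ∀ s ≤ (2 : ℝ), HasDerivWithinAt (cutoff β) (cutoffDeriv β s) (Set.Iic 2) s := by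
    intro s hs
    rw [cutoffDeriv_of_le β hs]
    exact (hasDerivWithinAt_const s _ (0 : ℝ)).congr (fun y hy => cutoff_of_le β hy)
      (cutoff_of_le β hs)
  have right : ∀ s, (2 : ℝ) ≤ s →
      HasDerivWithinAt (cutoff β) (cutoffDeriv β s) (Set.Ici 2) s := by
    intro s hs
    have h : HasDerivAt (fun y : ℝ => (y ^ (1 / β) - 2 ^ (1 / β)) ^ 2) (cutoffDeriv β s) s := by
      refine (((Real.hasDerivAt_rpow_const (x := s) (p := 1 / β)
        (Or.inl (by linarith))).sub_const _).pow 2).congr_deriv ?_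
      simp [cutoffDeriv, max_eq_left hs]
    exact h.hasDerivWithinAt.congr
      (fun y hy => by simp [cutoff, max_eq_left (show (2 : ℝ) ≤ y from hy)])
      (by simp [cutoff, max_eq_left hs])
  rcases lt_trichotomy t 2 with ht | rfl | ht
  · exact (left t ht.le).hasDerivAt (Iic_mem_nhds ht)
  · simpa using (left 2 le_rfl).union (right 2 le_rfl)
  · exact (right t ht.le).hasDerivAt (Ici_mem_nhds ht)

lemma rpow_one_div_sub_nonneg {β t : ℝ} (hβ : 0 < β) (ht : 2 ≤ t) :
    0 ≤ t ^ (1 / β) - 2 ^ (1 / β) :=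
  sub_nonneg.2 (Real.rpow_le_rpow (by norm_num) ht (by positivity))

lemma sq_rpow_one_div_rpow {β t : ℝ} (hβ : 0 < β) (ht : 0 ≤ t) :
    ((t ^ (1 / β)) ^ 2) ^ β = t ^ 2 := by
  rw [← Real.rpow_two, ← Real.rpow_mul ht, ← Real.rpow_mul ht, ← Real.rpow_two]
  congr 1
  field_simp

lemma cutoff_rpow_le {β t : ℝ} (hβ : 0 < β) (ht : 2 ≤ t) : cutoff β t ^ β ≤ t ^ 2 := by
  rw [← sq_rpow_one_div_rpow hβ (by linarith : 0 ≤ t)]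
  refine Real.rpow_le_rpow (cutoff_nonneg _ _) ?_ hβ.le
  rw [cutoff, max_eq_left ht]
  have : (0 : ℝ) ≤ 2 ^ (1 / β) := by positivity
  exact pow_le_pow_left₀ (rpow_one_div_sub_nonneg hβ ht) (by linarith) 2

/-- The threshold makes t^(1/β) at least twice the subtracted 2^(1/β), so the subtraction loses at
most a factor 2 before squaring, hence 4^β in the end. -/
lemma sq_le_cutoff_rpow {β t : ℝ} (hβ : 0 < β) (ht : 2 ^ (β + 1) ≤ t) :
    t ^ 2 ≤ 4 ^ β * cutoff β t ^ β := by
  have h2 : (2 : ℝ) ≤ 2 ^ (β + 1) := by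
    conv_lhs => rw [← Real.rpow_one 2]
    exact Real.rpow_le_rpow_of_exponent_le (by norm_num) (by linarith)
  have ht2 : 2 ≤ t := h2.trans ht
  rw [← sq_rpow_one_div_rpow hβ (by linarith : 0 ≤ t),
    ← Real.mul_rpow (by norm_num) (cutoff_nonneg _ _)]
  refine Real.rpow_le_rpow (by positivity) ?_ hβ.le
  rw [cutoff, max_eq_left ht2]
  have h3 : 2 * (2 : ℝ) ^ (1 / β) ≤ t ^ (1 / β) := by
    refine le_trans (le_of_eq ?_) (Real.rpow_le_rpow (by positivity) ht (by positivity))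
    rw [← Real.rpow_mul (by norm_num), ← Real.rpow_one_add' (by norm_num) (by positivity)]
    congr 1
    field_simp
  have h4 := rpow_one_div_sub_nonneg hβ ht2
  have h5 : (0 : ℝ) ≤ t ^ (1 / β) := by positivity
  nlinarith

/-- The derivative of the truncation is at most (2/β) t^(2/β) / t, and 2/β ≤ 1. With d = g' and t =
g the right-hand side is the energy density. -/
lemma abs_cutoffDeriv_mul_rpow_le {β t : ℝ} (d : ℝ) (hβ : 2 ≤ β) (ht : 2 ≤ t) :
    |cutoffDeriv β t * d| ^ β ≤ |d / t| ^ β * t ^ 2 := by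
  have hβ0 : 0 < β := by linarith
  have ht0 : 0 < t := by linarith
  rw [← sq_rpow_one_div_rpow hβ0 ht0.le, ← Real.mul_rpow (by positivity) (by positivity)]
  refine Real.rpow_le_rpow (by positivity) ?_ hβ0.le
  have h4 := rpow_one_div_sub_nonneg hβ0 ht
  have h5 : (0 : ℝ) ≤ t ^ (1 / β) := by positivity
  have h6 : (0 : ℝ) < 2 ^ (1 / β) := by positivity
  have h7 : t ^ (1 / β - 1) = t ^ (1 / β) / t := by
    rw [Real.rpow_sub_one ht0.ne']
  have h8 : 2 / β ≤ 1 := by rw [div_le_one hβ0]; exact hβ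
  rw [abs_mul, abs_div, abs_of_pos ht0, cutoffDeriv, max_eq_left ht, h7,
    abs_of_nonneg (by positivity)]
  have h9 : 2 * (t ^ (1 / β) - 2 ^ (1 / β)) * (1 / β * (t ^ (1 / β) / t)) * |d| =
      2 / β * (t ^ (1 / β) - 2 ^ (1 / β)) * (t ^ (1 / β) * (|d| / t)) := by ring
  have h10 : |d| / t * (t ^ (1 / β)) ^ 2 = 1 * t ^ (1 / β) * (t ^ (1 / β) * (|d| / t)) := by ring
  rw [h9, h10]
  gcongr
  linarith

/-! ### Entropy of a normalized positive part. -/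

lemma memLp_fPlus {μ : Measure ℝ} {g : ℝ → ℝ} (hg : MemLp g 2 μ) : MemLp (fPlus g) 2 μ :=
  hg.pos_part

lemma sub_one_le_mul_log {y : ℝ} (hy : 0 ≤ y) : y - 1 ≤ y * Real.log y := by
  rcases hy.eq_or_lt with rfl | hy
  · simp
  · have := Real.one_sub_inv_le_log_of_pos hy
    have h := mul_le_mul_of_nonneg_left this hy.le
    rwa [mul_sub, mul_inv_cancel₀ hy.ne', mul_one] at h

/-- The pointwise bound behind the entropy estimate. -/
lemma sq_mul_log_sq_le {β H s t : ℝ} (hβ : 0 < β) (ht : 0 ≤ t) (hH : 0 ≤ H) (hs : 0 ≤ s)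
    (hk : cutoff β t ^ β ≤ H * Real.exp s) :
    t ^ 2 * Real.log (t ^ 2) - t ^ 2 + 1 ≤
      (9 + 4 * Real.log ((2 ^ (β + 1)) ^ 2)) * (t - 1) ^ 2 +
        4 ^ β * ((β * Real.log 4 + H) * cutoff β t ^ β + s * cutoff β t ^ β) := by
  have hc : 0 ≤ cutoff β t ^ β := Real.rpow_nonneg (cutoff_nonneg _ _) _
  have hK : (1 : ℝ) ≤ 2 ^ (β + 1) := Real.one_le_rpow (by norm_num) (by linarith)
  have hlK : 0 ≤ Real.log ((2 ^ (β + 1)) ^ 2) := Real.log_nonneg (one_le_pow₀ hK)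
  have hl4 : 0 ≤ Real.log 4 := Real.log_nonneg (by norm_num)
  have hlast : 0 ≤ 4 ^ β * ((β * Real.log 4 + H) * cutoff β t ^ β + s * cutoff β t ^ β) := by
    positivity
  -- Three regimes: t ≤ 2, where log u ≤ u - 1 leaves (t + 1)² (t - 1)²; moderate t, where the
  -- logarithm is bounded and t² ≤ 4 (t - 1)²; and large t, where the truncation takes over.
  rcases le_total t 2 with h2 | h2
  · have e1 : t ^ 2 * Real.log (t ^ 2) ≤ t ^ 2 * (t ^ 2 - 1) := by
      rcases ht.eq_or_lt with rfl | ht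
      · simp
      · exact mul_le_mul_of_nonneg_left (Real.log_le_sub_one_of_pos (by positivity))
          (by positivity)
    have e2 : t ^ 2 * (t ^ 2 - 1) - t ^ 2 + 1 = (t + 1) ^ 2 * (t - 1) ^ 2 := by ring
    have e3 : (t + 1) ^ 2 ≤ 9 := by nlinarith
    have e4 := mul_le_mul_of_nonneg_right e3 (sq_nonneg (t - 1))
    have e5 := mul_nonneg hlK (sq_nonneg (t - 1))
    linarith
  have e0 : t ^ 2 ≤ 4 * (t - 1) ^ 2 := by nlinarith
  rcases le_total t (2 ^ (β + 1)) with h3 | h3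
  · have e1 : Real.log (t ^ 2) ≤ Real.log ((2 ^ (β + 1)) ^ 2) :=
      Real.log_le_log (by positivity) (pow_le_pow_left₀ ht h3 2)
    have e2 := mul_le_mul_of_nonneg_left e1 (sq_nonneg t)
    have e3 := mul_le_mul_of_nonneg_right e0 hlK
    nlinarith [sq_nonneg (t - 1)]
  · have e1 := sq_le_cutoff_rpow hβ h3
    have ht0 : 0 < t ^ 2 := by positivity
    have hl0 : 0 ≤ Real.log (t ^ 2) := Real.log_nonneg (by nlinarith)
    have hcpos : 0 < cutoff β t ^ β := by
      refine hc.lt_of_ne fun h => ?_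
      rw [← h, mul_zero] at e1
      linarith
    have hHpos : 0 < H := by
      refine hH.lt_of_ne fun h => ?_
      rw [← h, zero_mul] at hk
      linarith
    -- The logarithm of the pointwise bound `hk`, followed by log H ≤ H - 1.
    have e2 : Real.log (t ^ 2) ≤ β * Real.log 4 + H + s := by
      refine (Real.log_le_log ht0 e1).trans ?_
      rw [Real.log_mul (by positivity) hcpos.ne', Real.log_rpow (by norm_num)]
      have e3 := Real.log_le_log hcpos hk
      rw [Real.log_mul hHpos.ne' (Real.exp_pos _).ne', Real.log_exp] at e3
      have e4 := Real.log_le_sub_one_of_pos hHpos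
      linarith
    have e5 : t ^ 2 * Real.log (t ^ 2) ≤
        4 ^ β * cutoff β t ^ β * (β * Real.log 4 + H + s) :=
      mul_le_mul e1 e2 hl0 (by positivity)
    have e6 : 0 ≤ (9 + 4 * Real.log ((2 ^ (β + 1)) ^ 2)) * (t - 1) ^ 2 := by positivity
    nlinarith

/-- The entropy inequality for the positive part of a function, when it has norm one. -/
lemma exists_ent_fPlus_le_of_norm_one {α β : ℝ} (h : α.HolderConjugate β) (hβ2 : 2 ≤ β) :
    ∃ A B : ℝ, 0 < A ∧ 0 < B ∧ ∀ g : ℝ → ℝ, ContDiff ℝ 1 g → MemLp g 2 (muAlpha α) →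
      ∫ x, fPlus g x ^ 2 ∂(muAlpha α) = 1 →
      IntegrableOn (energyIntegrand β g) {x | 2 ≤ g x} (muAlpha α) →
      Integrable (fun x => fPlus g x ^ 2 * Real.log (fPlus g x ^ 2)) (muAlpha α) ∧
      ∫ x, fPlus g x ^ 2 * Real.log (fPlus g x ^ 2) ∂(muAlpha α) ≤
        A * (1 - (∫ x, fPlus g x ∂(muAlpha α)) ^ 2) +
          B * ∫ x in {x | 2 ≤ g x}, energyIntegrand β g x ∂(muAlpha α) := by
  obtain ⟨C, hC, hW⟩ := exists_weighted_bound h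
  have hα0 : 0 < α := h.pos
  have hβ0 : 0 < β := h.symm.pos
  have := isProbabilityMeasure_muAlpha hα0
  set μ := muAlpha α with hμ
  set C₁ := 9 + 4 * Real.log ((2 ^ (β + 1)) ^ 2) with hC₁
  have hl4 : 0 ≤ Real.log 4 := Real.log_nonneg (by norm_num)
  have hlK : 0 ≤ Real.log (((2 : ℝ) ^ (β + 1)) ^ 2) :=
    Real.log_nonneg (one_le_pow₀ (Real.one_le_rpow (by norm_num) (by linarith)))
  have hC₁0 : 0 < C₁ := by positivity
  -- H is used twice, once through H ∫ k^β and once for the α-moment, whence 8C = 2 · 4C and 2C; the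
  -- outer 2 converts ∫ (t - 1)² into the variance.
  refine ⟨2 * (C₁ + 4 ^ β * (4 * (β * Real.log 4) + 8 * C)), 4 ^ β * (2 * C), by positivity,
    by positivity, fun g hg hgL hg1 hE => ?_⟩
  have hgc : Continuous g := hg.continuous
  have hgc' : Continuous (deriv g) := hg.continuous_deriv le_rfl
  have hms : MeasurableSet {x | 2 ≤ g x} := measurableSet_le measurable_const hgc.measurable
  set t := fPlus g with ht
  have htL : MemLp t 2 μ := memLp_fPlus hgL
  have htc : Continuous t := hgc.max continuous_const
  have ht0 : ∀ x, 0 ≤ t x := fun x => le_max_right _ _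
  have hti : Integrable t μ := htL.integrable one_le_two
  have ht2 : Integrable (fun x => t x ^ 2) μ := htL.integrable_sq
  set m := ∫ x, t x ∂μ with hm
  have hm0 : 0 ≤ m := integral_nonneg ht0
  have hQi : Integrable (fun x => (t x - 1) ^ 2) μ := (htL.sub (memLp_const 1)).integrable_sq
  have hQ : ∫ x, (t x - 1) ^ 2 ∂μ = 2 - 2 * m := by
    have e : ∀ x, (t x - 1) ^ 2 = t x ^ 2 - 2 * t x + 1 := fun x => by ring
    simp only [e]
    have i0 : Integrable (fun x => t x ^ 2 - 2 * t x) μ := ht2.sub (hti.const_mul 2)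
    rw [integral_add i0 (integrable_const 1),
      integral_sub ht2 (hti.const_mul 2), hg1, integral_const_mul]
    simp
    ring
  have hQ0 : 0 ≤ ∫ x, (t x - 1) ^ 2 ∂μ := integral_nonneg fun x => sq_nonneg _
  -- Nonnegativity of 2 - 2m gives m ≤ 1, and with m ≥ 0 this yields m² ≤ m.
  have hQV : ∫ x, (t x - 1) ^ 2 ∂μ ≤ 2 * (1 - m ^ 2) := by nlinarith
  set k : ℝ → ℝ := fun x => cutoff β (g x) with hk
  set k' : ℝ → ℝ := fun x => cutoffDeriv β (g x) * deriv g x with hk'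
  have hkd : ∀ x, HasDerivAt k (k' x) x := fun x =>
    (hasDerivAt_cutoff β (g x)).comp x (hg.differentiable one_ne_zero x).hasDerivAt
  have hkc : Continuous k := continuous_iff_continuousAt.2 fun x => (hkd x).continuousAt
  have hk'c : Continuous k' := ((continuous_cutoffDeriv β).comp hgc).mul hgc'
  have hkt : ∀ x, k x = cutoff β (t x) := fun x => by
    rcases le_total (g x) 2 with h2 | h2
    · rw [hk, cutoff_of_le β (t := t x) (max_le h2 (by norm_num)), ← cutoff_of_le β h2]
    · rw [ht, fPlus, max_eq_left (by linarith)]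
  have hk0 : ∀ x, 0 ≤ k x ^ β := fun x => Real.rpow_nonneg (cutoff_nonneg _ _) _
  have hkle : ∀ x, k x ^ β ≤ t x ^ 2 ∧ k x ^ β ≤ 4 * (t x - 1) ^ 2 := fun x => by
    rw [hkt]
    rcases le_total (t x) 2 with h2 | h2
    · rw [cutoff_of_le β h2, Real.zero_rpow hβ0.ne']
      constructor <;> positivity
    · have := cutoff_rpow_le hβ0 h2
      exact ⟨this, this.trans (by nlinarith)⟩
  have hki : Integrable (fun x => k x ^ β) μ :=
    ht2.mono' (hkc.rpow_const fun _ => Or.inr hβ0.le).aestronglyMeasurable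
      (Eventually.of_forall fun x => by
        rw [Real.norm_of_nonneg (hk0 x)]; exact (hkle x).1)
  have hk'le : ∀ x, |k' x| ^ β ≤
      Set.indicator {x | 2 ≤ g x} (energyIntegrand β g) x := fun x => by
    by_cases hx : 2 ≤ g x
    · rw [Set.indicator_of_mem (show x ∈ {x | 2 ≤ g x} from hx)]
      exact abs_cutoffDeriv_mul_rpow_le _ hβ2 hx
    · rw [Set.indicator_of_notMem (show x ∉ {x | 2 ≤ g x} from hx)]
      simp [hk', cutoffDeriv_of_le β (not_le.1 hx).le, Real.zero_rpow hβ0.ne']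
  have hEi := (integrable_indicator_iff hms).2 hE
  have hk'i : Integrable (fun x => |k' x| ^ β) μ :=
    hEi.mono' (hk'c.abs.rpow_const fun _ => Or.inr hβ0.le).aestronglyMeasurable
      (Eventually.of_forall fun x => by
        rw [Real.norm_of_nonneg (by positivity)]; exact hk'le x)
  obtain ⟨hWi, hWle, hsup⟩ := hW k k' (fun x => cutoff_nonneg _ _) hkd hk'c hki hk'i
  set S := ∫ x, k x ^ β ∂μ with hS
  set D := ∫ x, |k' x| ^ β ∂μ with hD
  have hS0 : 0 ≤ S := integral_nonneg hk0
  have hD0 : 0 ≤ D := integral_nonneg fun x => by positivity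
  have hS1 : S ≤ 1 := hg1 ▸ integral_mono hki ht2 fun x => (hkle x).1
  have hSQ : S ≤ 4 * ∫ x, (t x - 1) ^ 2 ∂μ := by
    rw [← integral_const_mul]
    exact integral_mono hki (hQi.const_mul 4) fun x => (hkle x).2
  have hDE : D ≤ ∫ x in {x | 2 ≤ g x}, energyIntegrand β g x ∂μ := by
    rw [← integral_indicator hms]
    exact integral_mono hk'i hEi hk'le
  set H := C * (S + D) with hH
  have hH0 : 0 ≤ H := by positivity
  -- Subtracting t² - 1, of integral 0, makes the integrand nonnegative, so the upper bound alone
  -- yields integrability.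
  set G : ℝ → ℝ := fun x => t x ^ 2 * Real.log (t x ^ 2) - t x ^ 2 + 1 with hG
  have hG0 : ∀ x, 0 ≤ G x := fun x => by
    have := sub_one_le_mul_log (sq_nonneg (t x))
    simp only [hG]; linarith
  have hGle : ∀ x, G x ≤ C₁ * (t x - 1) ^ 2 +
      4 ^ β * ((β * Real.log 4 + H) * k x ^ β + |x| ^ α * k x ^ β) := fun x => by
    have := hsup x
    rw [hkt] at this ⊢
    exact sq_mul_log_sq_le hβ0 (ht0 x) hH0 (by positivity) this
  have i1 : Integrable (fun x => C₁ * (t x - 1) ^ 2) μ := hQi.const_mul C₁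
  have i2 : Integrable (fun x => (β * Real.log 4 + H) * k x ^ β) μ := hki.const_mul _
  have i3 : Integrable
      (fun x => 4 ^ β * ((β * Real.log 4 + H) * k x ^ β + |x| ^ α * k x ^ β)) μ :=
    (i2.add hWi).const_mul _
  have hLm : Measurable fun x => t x ^ 2 * Real.log (t x ^ 2) :=
    (htc.measurable.pow_const 2).mul (Real.measurable_log.comp (htc.measurable.pow_const 2))
  have hGm : Measurable G := (hLm.sub (htc.measurable.pow_const 2)).add_const 1
  have hGi : Integrable G μ := (i1.add i3).mono' hGm.aestronglyMeasurable
    (Eventually.of_forall fun x => by rw [Real.norm_of_nonneg (hG0 x)]; exact hGle x)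
  have hLG : (fun x => t x ^ 2 * Real.log (t x ^ 2)) = fun x => G x + (t x ^ 2 - 1) := by
    funext x; simp only [hG]; ring
  have i4 : Integrable (fun x => t x ^ 2 - 1) μ := ht2.sub (integrable_const 1)
  refine ⟨hLG ▸ hGi.add i4, ?_⟩
  rw [hLG, integral_add hGi i4, integral_sub ht2 (integrable_const 1), hg1]
  have hGint : ∫ x, G x ∂μ ≤ C₁ * ∫ x, (t x - 1) ^ 2 ∂μ +
      4 ^ β * ((β * Real.log 4 + H) * S + ∫ x, |x| ^ α * k x ^ β ∂μ) := by
    refine (integral_mono hGi (i1.add i3) hGle).trans_eq ?_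
    rw [integral_add' i1 i3, integral_const_mul, integral_const_mul, integral_add i2 hWi,
      integral_const_mul]
  simp only [integral_const, probReal_univ, smul_eq_mul, mul_one, sub_self, add_zero]
  refine hGint.trans ?_
  set Q := ∫ x, (t x - 1) ^ 2 ∂μ with hQd
  set E := ∫ x in {x | 2 ≤ g x}, energyIntegrand β g x ∂μ with hEd
  have b1 : (β * Real.log 4 + H) * S + ∫ x, |x| ^ α * k x ^ β ∂μ ≤
      (4 * (β * Real.log 4) + 8 * C) * Q + 2 * C * E := by
    have c1 : β * Real.log 4 * S ≤ β * Real.log 4 * (4 * Q) :=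
      mul_le_mul_of_nonneg_left hSQ (by positivity)
    -- The normalization makes the quadratic term H S linear.
    have c2 : H * S ≤ H := mul_le_of_le_one_right hH0 hS1
    have c3 : H ≤ C * (4 * Q + E) := mul_le_mul_of_nonneg_left (by linarith) hC.le
    linarith
  have b2 := mul_le_mul_of_nonneg_left b1 (by positivity : (0 : ℝ) ≤ 4 ^ β)
  have b3 : (C₁ + 4 ^ β * (4 * (β * Real.log 4) + 8 * C)) * Q ≤
      (C₁ + 4 ^ β * (4 * (β * Real.log 4) + 8 * C)) * (2 * (1 - m ^ 2)) :=
    mul_le_mul_of_nonneg_left hQV (by positivity)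
  linarith

/-! ### Signs, scaling and removal of the normalization. -/

lemma energyIntegrand_nonneg (β : ℝ) (f : ℝ → ℝ) (x : ℝ) : 0 ≤ energyIntegrand β f x := by
  unfold energyIntegrand; positivity

lemma energyIntegrand_neg (β : ℝ) (f : ℝ → ℝ) :
    energyIntegrand β (fun x => -f x) = energyIntegrand β f := by
  funext x
  simp [energyIntegrand, deriv.fun_neg, neg_div_neg_eq]

lemma energyIntegrand_div_const (β : ℝ) (f : ℝ → ℝ) {n : ℝ} (hn : n ≠ 0) :
    energyIntegrand β (fun x => f x / n) = fun x => energyIntegrand β f x / n ^ 2 := by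
  funext x
  simp only [energyIntegrand, deriv_div_const, div_div_div_cancel_right₀ hn, div_pow]
  ring

lemma fMinus_eq_fPlus_neg (f : ℝ → ℝ) : fMinus f = fPlus fun x => -f x := rfl

lemma fPlus_nonneg (f : ℝ → ℝ) (x : ℝ) : 0 ≤ fPlus f x := le_max_right _ _

lemma fPlus_sub_fMinus (f : ℝ → ℝ) (x : ℝ) : fPlus f x - fMinus f x = f x := by
  unfold fPlus fMinus
  rcases le_total 0 (f x) with h | h
  · rw [max_eq_left h, max_eq_right (by linarith)]; ring
  · rw [max_eq_right h, max_eq_left (by linarith)]; ring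

lemma fPlus_mul_fMinus (f : ℝ → ℝ) (x : ℝ) : fPlus f x * fMinus f x = 0 := by
  unfold fPlus fMinus
  rcases le_total 0 (f x) with h | h
  · rw [max_eq_right (b := (0 : ℝ)) (a := -f x) (by linarith), mul_zero]
  · rw [max_eq_right h, zero_mul]

/-- The entropy inequality for the positive part of a function. -/
lemma exists_ent_fPlus_le {α β : ℝ} (h : α.HolderConjugate β) (hβ2 : 2 ≤ β) :
    ∃ A B : ℝ, 0 < A ∧ 0 < B ∧ ∀ f : ℝ → ℝ, ContDiff ℝ 1 f → MemLp f 2 (muAlpha α) →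
      IntegrableOn (energyIntegrand β f)
        {x | 2 * √(∫ y, fPlus f y ^ 2 ∂(muAlpha α)) ≤ fPlus f x} (muAlpha α) →
      Integrable (entIntegrand (muAlpha α) fun x => fPlus f x ^ 2) (muAlpha α) ∧
      ent (muAlpha α) (fun x => fPlus f x ^ 2) ≤
        A * (∫ x, fPlus f x ^ 2 ∂(muAlpha α) - (∫ x, fPlus f x ∂(muAlpha α)) ^ 2) +
          B * ∫ x in {x | 2 * √(∫ y, fPlus f y ^ 2 ∂(muAlpha α)) ≤ fPlus f x},
            energyIntegrand β f x ∂(muAlpha α) := by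
  obtain ⟨A, B, hA, hB, hmain⟩ := exists_ent_fPlus_le_of_norm_one h hβ2
  refine ⟨A, B, hA, hB, fun f hf hfL hE => ?_⟩
  set μ := muAlpha α
  have hpL : MemLp (fPlus f) 2 μ := memLp_fPlus hfL
  set N := ∫ y, fPlus f y ^ 2 ∂μ with hN
  have hN0 : 0 ≤ N := integral_nonneg fun x => sq_nonneg _
  have hint : entIntegrand μ (fun x => fPlus f x ^ 2) =
      fun x => fPlus f x ^ 2 * Real.log (fPlus f x ^ 2 / N) := rfl
  -- If f₊ has norm zero, division by 0 makes the entropy integrand vanish, and the right-hand side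
  -- is nonnegative. Otherwise f is divided by that norm.
  rcases hN0.eq_or_lt with h0 | hNpos
  · have hp0 : ∀ᵐ x ∂μ, fPlus f x = 0 := by
      filter_upwards [(integral_eq_zero_iff_of_nonneg (fun x => sq_nonneg (fPlus f x))
        hpL.integrable_sq).1 (hN ▸ h0.symm)] with x hx
      exact pow_eq_zero_iff two_ne_zero |>.1 hx
    have hm : ∫ x, fPlus f x ∂μ = 0 := integral_eq_zero_of_ae hp0
    rw [ent, hint, ← h0, hm]
    simp only [div_zero, Real.log_zero, mul_zero]
    refine ⟨integrable_zero _ _ _, ?_⟩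
    simp only [integral_zero]
    have := integral_nonneg (μ := μ.restrict {x | 2 * √0 ≤ fPlus f x})
      (f := energyIntegrand β f) (fun x => energyIntegrand_nonneg β f x)
    have := mul_nonneg hB.le this
    simpa using this
  set n := √N with hn
  have hn0 : 0 < n := Real.sqrt_pos.2 hNpos
  have hn2 : n ^ 2 = N := Real.sq_sqrt hN0
  have hpd : ∀ x, fPlus (fun x => f x / n) x = fPlus f x / n := fun x => by
    simp only [fPlus]
    rw [← max_div_div_right hn0.le, zero_div]
  have hset : {x | 2 ≤ f x / n} = {x | 2 * n ≤ fPlus f x} := by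
    ext x
    simp only [Set.mem_ofPred_eq, fPlus, le_div_iff₀ hn0, le_max_iff]
    constructor
    · exact Or.inl
    · rintro (h1 | h1)
      · exact h1
      · linarith
  have key := hmain (fun x => f x / n) (hf.div_const n) (by
      simpa only [div_eq_mul_inv] using hfL.mul_const n⁻¹)
    (by simp only [hpd, div_pow, integral_div, hn2]; exact div_self hNpos.ne')
    (by
      rw [hset, energyIntegrand_div_const β f hn0.ne']
      exact hE.div_const _)
  rw [hset, energyIntegrand_div_const β f hn0.ne'] at key
  simp only [hpd, div_pow, integral_div, hn2] at key
  obtain ⟨k1, k2⟩ := key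
  have hfun : (fun x => fPlus f x ^ 2 * Real.log (fPlus f x ^ 2 / N)) =
      fun x => N * (fPlus f x ^ 2 / N * Real.log (fPlus f x ^ 2 / N)) := by
    funext x; field_simp
  refine ⟨by rw [hint, hfun]; exact k1.const_mul N, ?_⟩
  rw [ent, hint, hfun, integral_const_mul]
  refine (mul_le_mul_of_nonneg_left k2 hN0).trans_eq ?_
  field_simp

/-! ### Recombining the two signs. -/

/-- The entropy is subadditive under the decomposition into positive and negative parts. -/
lemma ent_sq_le {μ : Measure ℝ} {f : ℝ → ℝ} (hf : MemLp f 2 μ)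
    (h1 : Integrable (entIntegrand μ fun x => fPlus f x ^ 2) μ)
    (h2 : Integrable (entIntegrand μ fun x => fMinus f x ^ 2) μ) :
    Integrable (entIntegrand μ fun x => f x ^ 2) μ ∧
      ent μ (fun x => f x ^ 2) ≤ ent μ (fun x => fPlus f x ^ 2) +
        ent μ (fun x => fMinus f x ^ 2) := by
  have hp : Integrable (fun x => fPlus f x ^ 2) μ := (memLp_fPlus hf).integrable_sq
  have hm : Integrable (fun x => fMinus f x ^ 2) μ := (memLp_fPlus hf.neg).integrable_sq
  have hsq : ∀ x, f x ^ 2 = fPlus f x ^ 2 + fMinus f x ^ 2 := fun x => by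
    have := fPlus_mul_fMinus f x
    rw [← fPlus_sub_fMinus f x]
    linear_combination -2 * this
  set a := ∫ x, fPlus f x ^ 2 ∂μ with ha
  set b := ∫ x, fMinus f x ^ 2 ∂μ with hb
  have ha0 : 0 ≤ a := integral_nonneg fun x => sq_nonneg _
  have hb0 : 0 ≤ b := integral_nonneg fun x => sq_nonneg _
  have hN : ∫ x, f x ^ 2 ∂μ = a + b := by
    simp only [hsq]
    exact integral_add hp hm
  -- Splitting log(s/N) through log(s/c) fails when c = 0 unless s = 0 too, which holds almost
  -- everywhere.
  have hpa : ∀ᵐ x ∂μ, a = 0 → fPlus f x ^ 2 = 0 := by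
    by_cases h : a = 0
    · filter_upwards [(integral_eq_zero_iff_of_nonneg (fun x => sq_nonneg (fPlus f x)) hp).1 h]
        with x hx _ using hx
    · exact Eventually.of_forall fun x h' => absurd h' h
  have hmb : ∀ᵐ x ∂μ, b = 0 → fMinus f x ^ 2 = 0 := by
    by_cases h : b = 0
    · filter_upwards [(integral_eq_zero_iff_of_nonneg (fun x => sq_nonneg (fMinus f x)) hm).1 h]
        with x hx _ using hx
    · exact Eventually.of_forall fun x h' => absurd h' h
  have split : ∀ c s N : ℝ, 0 ≤ c → 0 ≤ s → c ≤ N → (c = 0 → s = 0) →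
      s * Real.log (s / N) = s * Real.log (s / c) + s * Real.log (c / N) := by
    intro c s N hc hs hcN hcs
    rcases hs.eq_or_lt with rfl | hs
    · simp
    have hc : 0 < c := hc.lt_of_ne fun e => hs.ne' (hcs e.symm)
    have hN : 0 < N := hc.trans_le hcN
    rw [Real.log_div hs.ne' hN.ne', Real.log_div hs.ne' hc.ne', Real.log_div hc.ne' hN.ne']
    ring
  have hlog : ∀ c N : ℝ, 0 ≤ c → c ≤ N → Real.log (c / N) ≤ 0 := fun c N hc hcN =>
    Real.log_nonpos (div_nonneg hc (hc.trans hcN)) (div_le_one_of_le₀ hcN (hc.trans hcN))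
  -- The last two terms integrate to a log(a/(a+b)) + b log(b/(a+b)) ≤ 0, which is the
  -- subadditivity.
  have hae : entIntegrand μ (fun x => f x ^ 2) =ᵐ[μ] fun x =>
      (entIntegrand μ (fun x => fPlus f x ^ 2) x + entIntegrand μ (fun x => fMinus f x ^ 2) x) +
        (fPlus f x ^ 2 * Real.log (a / (a + b)) + fMinus f x ^ 2 * Real.log (b / (a + b))) := by
    filter_upwards [hpa, hmb] with x hx1 hx2
    have e1 := split a _ (a + b) ha0 (sq_nonneg (fPlus f x)) (by linarith) hx1
    have e2 := split b _ (a + b) hb0 (sq_nonneg (fMinus f x)) (by linarith) hx2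
    simp only [entIntegrand, hN, ← ha, ← hb]
    have e3 : f x ^ 2 * Real.log (f x ^ 2 / (a + b)) =
        fPlus f x ^ 2 * Real.log (fPlus f x ^ 2 / (a + b)) +
          fMinus f x ^ 2 * Real.log (fMinus f x ^ 2 / (a + b)) := by
      rcases mul_eq_zero.1 (fPlus_mul_fMinus f x) with h0 | h0 <;> rw [hsq, h0] <;> simp
    rw [e3, e1, e2]
    ring
  have i1 := h1.add h2
  have i2 := (hp.mul_const (Real.log (a / (a + b)))).add (hm.mul_const (Real.log (b / (a + b))))
  refine ⟨(integrable_congr hae).2 (i1.add i2), ?_⟩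
  rw [ent, integral_congr_ae hae]
  have e4 := integral_add i1 i2
  have e5 := integral_add h1 h2
  have e6 := integral_add (hp.mul_const (Real.log (a / (a + b))))
    (hm.mul_const (Real.log (b / (a + b))))
  rw [integral_mul_const, integral_mul_const, ← ha, ← hb] at e6
  have e7 := mul_nonpos_of_nonneg_of_nonpos ha0 (hlog a (a + b) ha0 (by linarith))
  have e8 := mul_nonpos_of_nonneg_of_nonpos hb0 (hlog b (a + b) hb0 (by linarith))
  simp only [Pi.add_apply] at e4 e5 e6
  rw [e4, e5, e6]
  unfold ent
  linarith

/-- The integrand of the energy is nonnegative, so where it is not integrable the right-hand side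
is infinite and there is nothing to assert. Where it is integrable, the entropy is asserted to be
finite and to satisfy the inequality. -/
theorem mainTheorem6 (α β : ℝ) (hα : 1 < α) (hα2 : α ≤ 2) (hβ : 1 / α + 1 / β = 1) :
    ∃ A B : ℝ, 0 < A ∧ 0 < B ∧
      ∀ f : ℝ → ℝ, ContDiff ℝ ∞ f → MemLp f 2 (muAlpha α) →
        IntegrableOn (energyIntegrand β f) (bigSet (muAlpha α) f) (muAlpha α) →
          Integrable (entIntegrand (muAlpha α) (fun x => f x ^ 2)) (muAlpha α) ∧
          ent (muAlpha α) (fun x => f x ^ 2) ≤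
            A * variance f (muAlpha α) +
              B * ∫ x in bigSet (muAlpha α) f, energyIntegrand β f x ∂(muAlpha α) := by
  have hconj : α.HolderConjugate β :=
    Real.holderConjugate_iff.2 ⟨hα, by simpa only [one_div] using hβ⟩
  have hβ2 : 2 ≤ β := by
    have h1 := hconj.mul_eq_add
    have h2 := hconj.symm.pos
    nlinarith
  obtain ⟨A, B, hA, hB, hmain⟩ := exists_ent_fPlus_le hconj hβ2
  -- The energy over each of the two level sets is bounded by the energy over their union, hence the
  -- factor 2.
  refine ⟨A, 2 * B, hA, by positivity, fun f hf hfL hE => ?_⟩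
  have := isProbabilityMeasure_muAlpha (α := α) (by linarith)
  set μ := muAlpha α
  have hf1 : ContDiff ℝ 1 f := hf.of_le (by exact_mod_cast le_top)
  have hEneg := energyIntegrand_neg β f
  have hsubp : {x | 2 * √(∫ y, fPlus f y ^ 2 ∂μ) ≤ fPlus f x} ⊆ bigSet μ f :=
    Set.subset_union_left
  have hsubm : {x | 2 * √(∫ y, fPlus (fun x => -f x) y ^ 2 ∂μ) ≤ fPlus (fun x => -f x) x} ⊆
    bigSet μ f := Set.subset_union_right
  obtain ⟨ip, lp⟩ := hmain f hf1 hfL (hE.mono_set hsubp)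
  obtain ⟨im, lm⟩ := hmain (fun x => -f x) hf1.neg hfL.neg (by
    rw [hEneg]; exact hE.mono_set hsubm)
  rw [hEneg] at lm
  have hmono : ∀ s ⊆ bigSet μ f, ∫ x in s, energyIntegrand β f x ∂μ ≤
      ∫ x in bigSet μ f, energyIntegrand β f x ∂μ := fun s hs =>
    setIntegral_mono_set hE (Eventually.of_forall (energyIntegrand_nonneg β f))
      hs.eventuallyLE
  have ep := hmono _ hsubp
  have em := hmono _ hsubm
  rw [← fMinus_eq_fPlus_neg] at im lm em
  obtain ⟨hi, hle⟩ := ent_sq_le hfL ip im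
  refine ⟨hi, hle.trans ?_⟩
  have hpL : MemLp (fPlus f) 2 μ := memLp_fPlus hfL
  have hmL : MemLp (fMinus f) 2 μ := memLp_fPlus hfL.neg
  have hvar : variance f μ = (∫ x, fPlus f x ^ 2 ∂μ + ∫ x, fMinus f x ^ 2 ∂μ) -
      (∫ x, fPlus f x ∂μ - ∫ x, fMinus f x ∂μ) ^ 2 := by
    rw [variance_eq_sub hfL, ← integral_add hpL.integrable_sq hmL.integrable_sq,
      ← integral_sub (hpL.integrable one_le_two) (hmL.integrable one_le_two)]
    congr 1
    · refine integral_congr_ae (Eventually.of_forall fun x => ?_)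
      have := fPlus_mul_fMinus f x
      simp only [Pi.pow_apply]
      rw [← fPlus_sub_fMinus f x]
      linear_combination -2 * this
    · simp only [fPlus_sub_fMinus]
  have hmp : 0 ≤ ∫ x, fPlus f x ∂μ := integral_nonneg (fPlus_nonneg f)
  have hmm : 0 ≤ ∫ x, fMinus f x ∂μ := integral_nonneg (fPlus_nonneg _)
  -- Expanding the squared difference of the means leaves this cross term, with a favourable sign,
  -- in the variance of f.
  have hprod := mul_nonneg hA.le (mul_nonneg hmp hmm)
  have ep' := mul_le_mul_of_nonneg_left ep hB.le
  have em' := mul_le_mul_of_nonneg_left em hB.le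
  rw [hvar]
  linarith
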